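/- Let $k\ge 2$ be an integer. For $n\ge 0$ let $X_n^k$ be the $k$-ary rooted tree of depth $n$ (the root is at depth $0$, every node at depth less than $n$ has exactly $k$ children, and the nodes at depth $n$ are leaves). Let $\mu_n$ be the uniform distribution on the normalized eigenvalues $(\lambda+k)/(2k)$, where $\lambda$ runs over the eigenvalues, with multiplicity, of the adjacency matrix of $X_n^k$. Then $\mu_n$ converges weakly, as $n\to\infty$, to a probability measure $\mu$ on $\mathbb R$. Let $F$ be the distribution function of $\mu$, let $Q(t)=\inf\{x: t\le F(x)\}$ for $0<t<1$ be its quantile function (the limit of the ordered plots of the normalized eigenvalues against the proportion $t$ of eigenvalues), and let $\nu$ be the Lebesgue–Stieltjes measure of $Q$, i.e. the measure with $\nu(\mathbb R\setminus(0,1))=0$ and $\nu([s,t))=Q(t)-Q(s)$ for $0<s\le t<1$. Then $\nu$ is a singular distribution of Cantor type: it has no atoms, it is singular with respect to Lebesgue measure, and its (closed) support $K\subseteq[0,1]$ has Lebesgue measure zero. The endpoints of $K$, i.e. the points of $K$ that are endpoints of a connected component of $\mathbb R\setminus K$, are exactly the numbers $$\varepsilon\,\frac{(k-1)^2}{k^m-1}+\sum_{n=1}^{\infty}\frac{(k-1)^2}{k^n-1}\,\#\Big\{\ell\in\mathbb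 Z:\ \ell\ge 1,\ \ell<\frac{an}{m},\ \gcd(\ell,n)=1\Big\},$$ where $m\ge 1$, $0\le a\le m$, $\gcd(a,m)=1$, $\varepsilon\in\{0,1\}$, and $\varepsilon=0$ if $m=1$; all these series converge. (The case $m=1$ gives the two extreme points $0$ and $1$ of $K$.) -/

import Mathlib

open MeasureTheory ProbabilityTheory Filter Topology Set

noncomputable section

/-- The nodes of the `k`-ary rooted tree of depth `n`: words of length `d ≤ n` over an alphabet with
`k` letters. The length is the depth of the node, the empty word is the root. -/
abbrev KTreeVertex (k n : ℕ) : Type := Σ d : Fin (n + 1), (Fin (d : ℕ) → Fin k)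

/-- `v` is a child of `u`: the word `v` is the word `u` followed by one more letter. -/
def IsChildOf {k n : ℕ} (v u : KTreeVertex k n) : Prop :=
  ∃ h : (u.1 : ℕ) + 1 = (v.1 : ℕ), ∀ i : Fin (u.1 : ℕ), v.2 (Fin.cast h i.castSucc) = u.2 i

/-- The `k`-ary rooted tree of depth `n` as a graph: every node is joined to its children. -/
def kTree (k n : ℕ) : SimpleGraph (KTreeVertex k n) where
  Adj u v := IsChildOf u v ∨ IsChildOf v u
  symm := ⟨fun _ _ h => h.symm⟩
  loopless := ⟨fun u h => by
    rcases h with ⟨h, -⟩ | ⟨h, -⟩ <;> omega⟩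

open Classical in
/-- The adjacency matrix of the tree. -/
def kTreeAdj (k n : ℕ) : Matrix (KTreeVertex k n) (KTreeVertex k n) ℝ :=
  (kTree k n).adjMatrix ℝ

theorem kTreeAdj_isHermitian (k n : ℕ) : (kTreeAdj k n).IsHermitian := by
  classical
  unfold kTreeAdj
  ext i j
  simp [SimpleGraph.adjMatrix_apply, SimpleGraph.adj_comm]

/-- The root of the tree. -/
instance kTreeVertexNonempty (k n : ℕ) : Nonempty (KTreeVertex k n) :=
  ⟨⟨⟨0, Nat.succ_pos n⟩, fun i => absurd i.2 (Nat.not_lt_zero _)⟩⟩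

/-- The uniform distribution on the eigenvalues, counted with multiplicity and normalized by
`lam ↦ (lam + k) / (2 * k)`, of the adjacency matrix of the `k`-ary rooted tree of depth `n`. -/
def normSpecDistribution (k n : ℕ) : ProbabilityMeasure ℝ :=
  ⟨((PMF.uniformOfFintype (KTreeVertex k n)).map
      fun v => ((kTreeAdj_isHermitian k n).eigenvalues v + k) / (2 * k)).toMeasure, inferInstance⟩

/-- The quantile function `t ↦ inf {x | t ≤ F x}`, for `0 < t < 1`, of a probability distribution on
the line with distribution function `F`. For the uniform distribution on a finite multiset it is the
increasing enumeration (ordered plot) of the multiset, rescaled to the unit interval. -/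
def quantile (μ : Measure ℝ) (t : ℝ) : ℝ := sInf {x : ℝ | t ≤ cdf μ x}

/-- `ν` is the Lebesgue-Stieltjes measure on the open unit interval of the (nondecreasing and
left-continuous) quantile function of `μ`. -/
def IsQuantileMeasure (μ ν : Measure ℝ) : Prop :=
  ν (Ioo 0 1)ᶜ = 0 ∧
    ∀ s t : ℝ, 0 < s → s ≤ t → t < 1 → ν (Ico s t) = ENNReal.ofReal (quantile μ t - quantile μ s)

/-- The endpoints of a closed set `K` of reals: the points of `K` that bound an open interval
disjoint from `K`, that is, the points of `K` that are endpoints of a component of the complement. -/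
def endpoints (K : Set ℝ) : Set ℝ :=
  {x ∈ K | (∃ y, x < y ∧ Disjoint (Ioo x y) K) ∨ (∃ y, y < x ∧ Disjoint (Ioo y x) K)}

/-- The number `(k - 1) ^ 2 / (k ^ n - 1)`. -/
def stairWidth (k n : ℕ) : ℝ := ((k : ℝ) - 1) ^ 2 / ((k : ℝ) ^ n - 1)

/-- The number of positive integers `l` coprime to `n` with `l < a * n / m`. -/
def coprimeCount (a m n : ℕ) : ℕ :=
  {l : ℕ | 0 < l ∧ Nat.gcd l n = 1 ∧ (l : ℝ) < (a : ℝ) * n / m}.ncard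

end

/-! Eliminating from the leaves to the root turns `x - A` into a diagonal matrix whose entry at
depth `d` is `p_{n-d+1}(x) / p_{n-d}(x)`, where `p_j` is a rescaled Chebyshev polynomial of the
second kind with roots `2√k cos(πl/(j+1))`, `0 < l < j+1`. Hence (`charpoly_kTreeAdj_mul`,
`sum_eigenvalues_kTreeAdj`) a sum over the spectrum is a combination, with weights `k^(n-h)`, of the
increments `S_{h+1} - S_h`, where `S_j` is the sum over the roots of `p_j`.

After division by the number of nodes, summation by parts (`tendsto_average_increments`) gives a
limit with weight `(k-1)^2 k^(-N)` on each fraction `l/N`, reduced or not. Collecting equal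
fractions (`hasSum_stairWidth_mul`) gives a geometric series: the reduced fraction with denominator
`q` gets mass `(k-1)^2/(k^q-1)`. So `μ` is purely atomic, with atoms at the images of the rationals
of `(0,1)` under an increasing continuous map (`treeMeasure`).

The rest holds for any probability measure whose atoms carry it and are dense in an interval `(a,b)`
(`IsDenselyAtomic`). Its distribution function `F` is strictly increasing there, and by the
adjunction between `F` and the quantile function, `ν` is the image under `F` of Lebesgue measure on
`(a,b)`. Strict monotonicity excludes atoms of `ν`. The support is `[0,1]` without the jump
intervals `(F(c-), F(c))`, whose lengths are the masses of the atoms and add up to 1, so the support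
is null. Its endpoints are 0, 1 and the two ends of each jump; counting reduced fractions below
`a/m` by denominator turns `F(c-)` into the stated series. -/

/-! ### Spectrum of the finite trees. -/

section TreeCharpoly

open Matrix

variable {k n : ℕ}

open Classical in
/-- The matrix of the parent-child relation, with the column of each vertex scaled by a weight. -/
noncomputable def childMatrix (k n : ℕ) (g : KTreeVertex k n → ℝ) :
    Matrix (KTreeVertex k n) (KTreeVertex k n) ℝ :=
  fun u v => if IsChildOf v u then g v else 0

theorem isChildOf_unique {u u' v : KTreeVertex k n} (h : IsChildOf v u) (h' : IsChildOf v u') :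
    u = u' := by
  obtain ⟨⟨d, hd⟩, w⟩ := u
  obtain ⟨⟨d', hd'⟩, w'⟩ := u'
  obtain ⟨e, hw⟩ := h
  obtain ⟨e', hw'⟩ := h'
  obtain rfl : d = d' := by
    dsimp only at e e'
    omega
  congr 1
  funext i
  exact (hw i).symm.trans (hw' i)

theorem isChildOf_depth {u v : KTreeVertex k n} (h : IsChildOf v u) :
    (v.1 : ℕ) = (u.1 : ℕ) + 1 := h.1.symm

/-- The child of `u` reached by the letter `c`. -/
def childOf (u : KTreeVertex k n) (h : (u.1 : ℕ) < n) (c : Fin k) : KTreeVertex k n :=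
  ⟨⟨(u.1 : ℕ) + 1, by omega⟩, Fin.snoc (α := fun _ => Fin k) u.2 c⟩

theorem childOf_injective (u : KTreeVertex k n) (h : (u.1 : ℕ) < n) :
    Function.Injective (childOf u h) := by
  intro c c' hc
  have h2 := eq_of_heq (Sigma.mk.inj hc).2
  have := congrFun h2 (Fin.last _)
  simpa using this

theorem isChildOf_iff_exists (u v : KTreeVertex k n) (h : (u.1 : ℕ) < n) :
    IsChildOf v u ↔ ∃ c, childOf u h c = v := by
  constructor
  · rintro ⟨e, hw⟩
    obtain ⟨⟨d, hd⟩, w⟩ := v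
    dsimp only at e
    subst e
    refine ⟨w (Fin.last _), ?_⟩
    unfold childOf
    congr 1
    funext i
    refine Fin.lastCases ?_ (fun j => ?_) i
    · simp
    · rw [Fin.snoc_castSucc]
      exact (hw j).symm
  · rintro ⟨c, rfl⟩
    refine ⟨rfl, fun i => ?_⟩
    exact Fin.snoc_castSucc (α := fun _ => Fin k) c u.2 i

open Classical in
theorem sum_children (u : KTreeVertex k n) (g : ℕ → ℝ) :
    ∑ v : KTreeVertex k n, (if IsChildOf v u then g v.1 else 0) =
      if (u.1 : ℕ) < n then k * g (u.1 + 1) else 0 := by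
  split_ifs with h
  · rw [← Finset.sum_filter]
    have : Finset.univ.filter (fun v => IsChildOf v u) = Finset.univ.image (childOf u h) := by
      ext v
      simp [isChildOf_iff_exists u v h]
    rw [this, Finset.sum_image ((childOf_injective u h).injOn)]
    simp [childOf]
  · refine Finset.sum_eq_zero fun v _ => if_neg fun hv => h ?_
    have := isChildOf_depth hv
    have := v.1.2
    omega

/-- Children lie one level deeper, so the matrix is block triangular for the depth, with identity
blocks on the diagonal. -/
theorem det_one_sub_childMatrix (g : KTreeVertex k n → ℝ) :
    (1 - childMatrix k n g).det = 1 := by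
  classical
  have hb : BlockTriangular (1 - childMatrix k n g) fun v => v.1 := by
    intro u v huv
    have h1 : u ≠ v := by
      rintro rfl
      exact lt_irrefl _ huv
    have h2 : ¬ IsChildOf v u := fun h => by
      have := isChildOf_depth h
      have : (v.1 : ℕ) < u.1 := huv
      omega
    simp [childMatrix, h1, h2]
  rw [hb.det_fintype]
  refine Finset.prod_eq_one fun d _ => ?_
  suffices h : (1 - childMatrix k n g).toSquareBlock (fun v => v.1) d = 1 by
    rw [h, Matrix.det_one]
  ext ⟨u, hu⟩ ⟨v, hv⟩
  have h2 : ¬ IsChildOf v u := fun h => by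
    have := isChildOf_depth h
    rw [hu, hv] at this
    omega
  simp [toSquareBlock_def, childMatrix, h2, Matrix.one_apply]

/-- If `g` solves the recursion of the pivots then Gaussian elimination from the leaves to the root
diagonalizes `x - A`. -/
theorem scalar_sub_kTreeAdj_eq (x : ℝ) (g : ℕ → ℝ) (hg : ∀ d ≤ n, g d ≠ 0)
    (hrec : ∀ d ≤ n, g d + (if d < n then k * (g (d + 1))⁻¹ else 0) = x) :
    Matrix.scalar (KTreeVertex k n) x - kTreeAdj k n =
      (1 - childMatrix k n fun v => (g v.1)⁻¹) * Matrix.diagonal (fun v => g v.1) *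
        (1 - childMatrix k n fun v => (g v.1)⁻¹)ᵀ := by
  classical
  have hle : ∀ v : KTreeVertex k n, (v.1 : ℕ) ≤ n := fun v => Nat.lt_succ_iff.1 v.1.2
  have hCD : (childMatrix k n fun v => (g v.1)⁻¹) * Matrix.diagonal (fun v => g v.1) =
      childMatrix k n fun _ => 1 := by
    ext u v
    rw [Matrix.mul_diagonal]
    unfold childMatrix
    split_ifs
    · exact inv_mul_cancel₀ (hg _ (hle v))
    · simp
  have hDC : Matrix.diagonal (fun v : KTreeVertex k n => g v.1) *
      (childMatrix k n fun v => (g v.1)⁻¹)ᵀ = (childMatrix k n fun _ => 1)ᵀ := by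
    rw [← hCD, Matrix.transpose_mul, Matrix.diagonal_transpose]
  -- This is diagonal because distinct nodes have no common child; the diagonal entry counts the `k`
  -- children, or none at a leaf.
  have hCC : (childMatrix k n fun _ => 1) * (childMatrix k n fun v => (g v.1)⁻¹)ᵀ =
      Matrix.diagonal fun v => if (v.1 : ℕ) < n then k * (g (v.1 + 1))⁻¹ else 0 := by
    ext u u'
    rw [Matrix.mul_apply, Matrix.diagonal_apply]
    split_ifs with huu hu
    · subst huu
      have := sum_children u fun d => (g d)⁻¹
      rw [if_pos hu] at this
      rw [← this]
      refine Finset.sum_congr rfl fun v _ => ?_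
      simp only [childMatrix, Matrix.transpose_apply]
      split_ifs <;> simp
    · subst huu
      have := sum_children u fun d => (g d)⁻¹
      rw [if_neg hu] at this
      rw [← this]
      refine Finset.sum_congr rfl fun v _ => ?_
      simp only [childMatrix, Matrix.transpose_apply]
      split_ifs <;> simp
    · refine Finset.sum_eq_zero fun v _ => ?_
      simp only [childMatrix, Matrix.transpose_apply]
      split_ifs with h1 h2
      · exact absurd (isChildOf_unique h1 h2) huu
      all_goals simp
  have hA : kTreeAdj k n = (childMatrix k n fun _ => 1) + (childMatrix k n fun _ => 1)ᵀ := by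
    ext u v
    have hadj : kTreeAdj k n u v = if IsChildOf u v ∨ IsChildOf v u then 1 else 0 := by
      unfold kTreeAdj
      rw [SimpleGraph.adjMatrix_apply]
      exact if_congr Iff.rfl rfl rfl
    rw [hadj]
    simp only [Matrix.add_apply, Matrix.transpose_apply, childMatrix]
    by_cases h1 : IsChildOf v u <;> by_cases h2 : IsChildOf u v
    · have := isChildOf_depth h1
      have := isChildOf_depth h2
      omega
    all_goals simp [h1, h2]
  rw [Matrix.transpose_sub, Matrix.transpose_one, sub_mul, one_mul, hCD, mul_sub, mul_one, sub_mul,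
    hDC, hCC, hA]
  have hx : Matrix.scalar (KTreeVertex k n) x = Matrix.diagonal (fun v => g v.1) +
      Matrix.diagonal fun v => if (v.1 : ℕ) < n then k * (g (v.1 + 1))⁻¹ else 0 := by
    rw [Matrix.diagonal_add, Matrix.scalar_apply]
    congr 1
    funext v
    exact (hrec _ (hle v)).symm
  rw [hx]
  abel

/-- The characteristic polynomials of the paths with edge weights `√k`. -/
noncomputable def pathPoly (k : ℕ) : ℕ → Polynomial ℝ
  | 0 => 1
  | 1 => Polynomial.X
  | j + 2 => Polynomial.X * pathPoly k (j + 1) - Polynomial.C (k : ℝ) * pathPoly k j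

/-- The substitution `x = 2√k y` and the factor `√k^j` turn the recursion `U_{j+2} = 2y U_{j+1} -
U_j` into that of `pathPoly`. -/
theorem pathPoly_eq_comp (hk : 0 < k) (j : ℕ) : pathPoly k j = Polynomial.C (√(k : ℝ) ^ j) *
    (Polynomial.Chebyshev.U ℝ j).comp (Polynomial.C (2 * √(k : ℝ))⁻¹ * Polynomial.X) := by
  have hs : √(k : ℝ) ≠ 0 := (Real.sqrt_pos.2 (by exact_mod_cast hk)).ne'
  have hs2 : (k : ℝ) = √(k : ℝ) ^ 2 := (Real.sq_sqrt (Nat.cast_nonneg k)).symm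
  have hc : Polynomial.C (√(k : ℝ)) * (2 * (Polynomial.C (2 * √(k : ℝ))⁻¹ * Polynomial.X)) =
      (Polynomial.X : Polynomial ℝ) := by
    rw [← Polynomial.C_ofNat, ← mul_assoc, ← mul_assoc, ← Polynomial.C_mul, ← Polynomial.C_mul]
    rw [show √(k : ℝ) * 2 * (2 * √(k : ℝ))⁻¹ = 1 by field_simp]
    simp
  generalize Polynomial.C (2 * √(k : ℝ))⁻¹ * Polynomial.X = Y at hc ⊢
  induction j using Nat.twoStepInduction with
  | zero => simp [pathPoly]
  | one =>
    simp only [pathPoly, Nat.cast_one, Polynomial.Chebyshev.U_one, Polynomial.mul_comp,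
      Polynomial.X_comp, pow_one]
    rw [Polynomial.ofNat_comp]
    exact_mod_cast hc.symm
  | more j ih1 ih2 =>
    rw [pathPoly, ih1, ih2]
    push_cast
    rw [Polynomial.Chebyshev.U_add_two]
    simp only [Polynomial.sub_comp, Polynomial.mul_comp, Polynomial.X_comp, Polynomial.ofNat_comp,
      pow_succ, Polynomial.C_mul]
    conv_lhs => rw [← hc]; arg 2; arg 1; rw [hs2, pow_two, Polynomial.C_mul]
    generalize (Polynomial.Chebyshev.U ℝ ((j : ℤ) + 1)).comp Y = P
    generalize (Polynomial.Chebyshev.U ℝ (j : ℤ)).comp Y = Q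
    ring

theorem pathPoly_ne_zero (hk : 0 < k) (j : ℕ) : pathPoly k j ≠ 0 := by
  have hs : √(k : ℝ) ≠ 0 := (Real.sqrt_pos.2 (by exact_mod_cast hk)).ne'
  rw [pathPoly_eq_comp hk]
  refine mul_ne_zero (Polynomial.C_ne_zero.2 (pow_ne_zero _ hs)) ?_
  rw [Ne, Polynomial.comp_C_mul_X_eq_zero_iff (mem_nonZeroDivisors_of_ne_zero (by positivity))]
  exact Polynomial.Chebyshev.U_ne_zero ℝ _ (by omega)

theorem roots_pathPoly (hk : 0 < k) (j : ℕ) : (pathPoly k j).roots =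
    (Multiset.range j).map fun l : ℕ =>
      2 * √(k : ℝ) * Real.cos ((l + 1) * Real.pi / (j + 1)) := by
  have hs : √(k : ℝ) ≠ 0 := (Real.sqrt_pos.2 (by exact_mod_cast hk)).ne'
  rw [pathPoly_eq_comp hk, Polynomial.roots_C_mul _ (pow_ne_zero _ hs)]
  have := Polynomial.roots_comp_C_mul_X_add_C (Polynomial.Chebyshev.U ℝ j) (2 * √(k : ℝ))⁻¹ 0
    (by simpa using hs)
  simp only [Polynomial.C_0, add_zero] at this
  rw [this, Polynomial.Chebyshev.roots_U_real, Finset.image_val,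
    Multiset.dedup_eq_self.2 (by simpa using Polynomial.Chebyshev.roots_U_real_nodup j)]
  simp [Ring.inverse_eq_inv']

/-- The determinant is the product of the pivots, which are quotients of consecutive path
polynomials; their denominators are moved to the left side. -/
theorem charpoly_kTreeAdj_mul (hk : 0 < k) (n : ℕ) :
    (kTreeAdj k n).charpoly * ∏ v : KTreeVertex k n, pathPoly k (n - v.1) =
      ∏ v : KTreeVertex k n, pathPoly k (n - v.1 + 1) := by
  classical
  -- `P` gathers every polynomial that must not vanish at `x`; comparing values off its finitely
  -- many roots is enough.
  set P : Polynomial ℝ := ∏ j ∈ Finset.range (n + 2), pathPoly k j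
  have hP : P ≠ 0 := Finset.prod_ne_zero_iff.2 fun j _ => pathPoly_ne_zero hk j
  refine Polynomial.eq_of_infinite_eval_eq _ _
    (Set.Infinite.mono ?_ (P.roots.toFinset.finite_toSet.infinite_compl))
  intro x hx
  have hne : ∀ j ≤ n + 1, (pathPoly k j).eval x ≠ 0 := by
    intro j hj h0
    refine hx ?_
    rw [Finset.mem_coe, Multiset.mem_toFinset, Polynomial.mem_roots hP, Polynomial.IsRoot,
      Polynomial.eval_prod]
    exact Finset.prod_eq_zero (Finset.mem_range.2 (by omega)) h0
  set g : ℕ → ℝ := fun d => (pathPoly k (n - d + 1)).eval x / (pathPoly k (n - d)).eval x with hgdef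
  have hg : ∀ d ≤ n, g d ≠ 0 := fun d _ => div_ne_zero (hne _ (by omega)) (hne _ (by omega))
  have hrec : ∀ d ≤ n, g d + (if d < n then k * (g (d + 1))⁻¹ else 0) = x := by
    intro d hd
    rcases hd.eq_or_lt with rfl | hlt
    · simp [hgdef, pathPoly]
    · rw [if_pos hlt]
      obtain ⟨j, rfl⟩ : ∃ j, n = d + j + 1 := ⟨n - d - 1, by omega⟩
      have e1 : d + j + 1 - d = j + 1 := by omega
      have e2 : d + j + 1 - (d + 1) = j := by omega
      simp only [hgdef, e1, e2, pathPoly]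
      have h1 := hne j (by omega)
      have h2 := hne (j + 1) (by omega)
      simp only [Polynomial.eval_sub, Polynomial.eval_mul, Polynomial.eval_X, Polynomial.eval_C]
      field_simp
      ring
  have hle : ∀ v : KTreeVertex k n, (v.1 : ℕ) ≤ n := fun v => Nat.lt_succ_iff.1 v.1.2
  show Polynomial.eval x _ = Polynomial.eval x _
  rw [Polynomial.eval_mul, Matrix.eval_charpoly, scalar_sub_kTreeAdj_eq x g hg hrec,
    Matrix.det_mul, Matrix.det_mul, Matrix.det_transpose, det_one_sub_childMatrix, one_mul, mul_one,
    Matrix.det_diagonal, Polynomial.eval_prod, Polynomial.eval_prod, ← Finset.prod_mul_distrib]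
  refine Finset.prod_congr rfl fun v _ => ?_
  exact div_mul_cancel₀ _ (hne _ (by omega))

/-- The sum of the values of `f` at the eigenvalues of the weighted path with `j` vertices. -/
noncomputable def pathSum (k : ℕ) (f : ℝ → ℝ) (j : ℕ) : ℝ :=
  ∑ l ∈ Finset.range j, f (2 * √(k : ℝ) * Real.cos ((l + 1) * Real.pi / (j + 1)))

/-- Compare the roots on both sides of `charpoly_kTreeAdj_mul`. The index `h` is the height `n - d`,
and `k^(n-h)` is the number of nodes at that height. -/
theorem sum_eigenvalues_kTreeAdj (hk : 0 < k) (n : ℕ) (f : ℝ → ℝ) :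
    ∑ v, f ((kTreeAdj_isHermitian k n).eigenvalues v) =
      ∑ h ∈ Finset.range (n + 1), (k : ℝ) ^ (n - h) * (pathSum k f (h + 1) - pathSum k f h) := by
  classical
  have hpoly := congrArg (fun p => (p.roots.map f).sum) (charpoly_kTreeAdj_mul hk n)
  have hp : ∀ g : ℕ → ℕ, ∏ v : KTreeVertex k n, pathPoly k (g v.1) ≠ 0 := fun g =>
    Finset.prod_ne_zero_iff.2 fun v _ => pathPoly_ne_zero hk _
  have hroots : ∀ g : ℕ → ℕ, ((∏ v : KTreeVertex k n, pathPoly k (g v.1)).roots.map f).sum =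
      ∑ v : KTreeVertex k n, pathSum k f (g v.1) := by
    intro g
    rw [Polynomial.roots_prod _ _ (hp g), Multiset.map_bind, Multiset.sum_bind]
    simp only [roots_pathPoly hk, Multiset.map_map]
    rfl
  rw [Polynomial.roots_mul (mul_ne_zero (Matrix.charpoly_monic _).ne_zero (hp fun d => n - d)),
    Multiset.map_add, Multiset.sum_add, (kTreeAdj_isHermitian k n).roots_charpoly_eq_eigenvalues,
    hroots fun d => n - d, hroots fun d => n - d + 1] at hpoly
  have hE : (Multiset.map f (Multiset.map (RCLike.ofReal ∘ (kTreeAdj_isHermitian k n).eigenvalues)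
      Finset.univ.val)).sum = ∑ v, f ((kTreeAdj_isHermitian k n).eigenvalues v) := by
    rw [Multiset.map_map]
    rfl
  rw [hE] at hpoly
  rw [eq_sub_of_add_eq hpoly, ← Finset.sum_sub_distrib, Fintype.sum_sigma]
  simp only [Finset.sum_const, Finset.card_univ, Fintype.card_fun, Fintype.card_fin, nsmul_eq_mul]
  rw [Fin.sum_univ_eq_sum_range fun d => ((k ^ d : ℕ) : ℝ) *
    (pathSum k f (n - d + 1) - pathSum k f (n - d)), ← Finset.sum_range_reflect]
  refine Finset.sum_congr rfl fun h hh => ?_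
  have : h ≤ n := Nat.lt_succ_iff.1 (Finset.mem_range.1 hh)
  rw [show n + 1 - 1 - h = n - h by omega, show n - (n - h) = h by omega]
  push_cast
  rfl

end TreeCharpoly

/-! ### Weights on the rationals of the unit interval. -/

section RationalAtoms

/-- The sum of `g` over the fractions with denominator `n` in the open unit interval. -/
def fractionSum (g : ℚ → ℝ) (n : ℕ) : ℝ := ∑ l ∈ Finset.Ioo 0 n, g ((l : ℚ) / n)

/-- The rationals of the open unit interval. -/
abbrev UnitRat : Type := {r : ℚ // 0 < r ∧ r < 1}

theorem abs_fractionSum_le {g : ℚ → ℝ} {B : ℝ} (hB : ∀ r, |g r| ≤ B) (n : ℕ) :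
    |fractionSum g n| ≤ n * B := by
  have hB0 : 0 ≤ B := (abs_nonneg _).trans (hB 0)
  refine (Finset.abs_sum_le_sum_abs _ _).trans ?_
  refine (Finset.sum_le_card_nsmul _ _ B fun l _ => hB _).trans ?_
  rw [nsmul_eq_mul]
  gcongr
  simp

variable {k : ℕ}

theorem summable_geometric_mul_of_linear_bound (hk : 2 ≤ k) {S : ℕ → ℝ} {B : ℝ}
    (hS : ∀ n, |S n| ≤ n * B) : Summable fun n => ((k : ℝ)⁻¹) ^ n * S n := by
  have hk' : (2 : ℝ) ≤ k := by exact_mod_cast hk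
  have hq : ‖(k : ℝ)⁻¹‖ < 1 := by
    rw [norm_inv, Real.norm_of_nonneg (by linarith)]
    exact inv_lt_one_of_one_lt₀ (by linarith)
  have := (summable_pow_mul_geometric_of_norm_lt_one 1 hq).mul_left B
  refine Summable.of_norm_bounded this fun n => ?_
  rw [norm_mul, Real.norm_eq_abs (S n), norm_pow, norm_inv, Real.norm_of_nonneg (by linarith)]
  calc ((k : ℝ)⁻¹) ^ n * |S n| ≤ ((k : ℝ)⁻¹) ^ n * (n * B) := by gcongr; exact hS n
    _ = B * ((n : ℝ) ^ 1 * ((k : ℝ)⁻¹) ^ n) := by ring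

/-- The exponents run over the positive multiples of `q`, the denominators with which a reduced
fraction of denominator `q` can be written. -/
theorem hasSum_stairWidth (hk : 2 ≤ k) (q : ℕ) (hq : 0 < q) :
    HasSum (fun i : ℕ => ((k : ℝ) - 1) ^ 2 * ((k : ℝ)⁻¹) ^ (q * (i + 1))) (stairWidth k q) := by
  have hk' : (2 : ℝ) ≤ k := by exact_mod_cast hk
  have h1 : (1 : ℝ) < (k : ℝ) ^ q := one_lt_pow₀ (by linarith) hq.ne'
  have hlt : ((k : ℝ)⁻¹) ^ q < 1 := by
    rw [inv_pow]
    exact inv_lt_one_of_one_lt₀ h1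
  have := (hasSum_geometric_of_lt_one (r := ((k : ℝ)⁻¹) ^ q) (by positivity) hlt).mul_left
    (((k : ℝ) - 1) ^ 2 * ((k : ℝ)⁻¹) ^ q)
  have hval : stairWidth k q =
      ((k : ℝ) - 1) ^ 2 * ((k : ℝ)⁻¹) ^ q * (1 - ((k : ℝ)⁻¹) ^ q)⁻¹ := by
    unfold stairWidth
    rw [inv_pow] at hlt ⊢
    have h2 : (k : ℝ) ^ q - 1 ≠ 0 := by linarith
    have h3 : (k : ℝ) ^ q ≠ 0 := by linarith
    have h4 : 1 - ((k : ℝ) ^ q)⁻¹ ≠ 0 := by linarith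
    field_simp
  rw [hval]
  refine HasSum.congr_fun this fun i => ?_
  rw [pow_mul, pow_succ]
  ring

theorem UnitRat.num_natAbs_div_den (r : UnitRat) : ((r.1.num.natAbs : ℕ) : ℚ) / r.1.den = r.1 := by
  have : ((r.1.num.natAbs : ℕ) : ℚ) = (r.1.num : ℚ) := by
    rw [← Int.cast_natCast, Int.natAbs_of_nonneg (Rat.num_pos.2 r.2.1).le]
  rw [this, Rat.num_div_den]

theorem UnitRat.natAbs_num_pos (r : UnitRat) : 0 < r.1.num.natAbs :=
  Int.natAbs_pos.2 (Rat.num_pos.2 r.2.1).ne'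

theorem UnitRat.natAbs_num_lt_den (r : UnitRat) : r.1.num.natAbs < r.1.den := by
  have h := r.2.2
  rw [← r.num_natAbs_div_den, div_lt_one (by exact_mod_cast r.1.den_pos)] at h
  exact_mod_cast h

theorem UnitRat.cast_eq_div (r : UnitRat) : (r.1 : ℝ) = (r.1.num.natAbs : ℝ) / r.1.den := by
  have h := congrArg (Rat.cast : ℚ → ℝ) r.num_natAbs_div_den
  rw [Rat.cast_div, Rat.cast_natCast, Rat.cast_natCast] at h
  exact h.symm

/-- A reduced fraction and a factor by which to expand it. -/
def expandFraction (p : UnitRat × ℕ) : ℕ × ℕ :=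
  (p.1.1.den * (p.2 + 1), p.1.1.num.natAbs * (p.2 + 1))

theorem expandFraction_div (p : UnitRat × ℕ) :
    (((expandFraction p).2 : ℕ) : ℚ) / ((expandFraction p).1 : ℕ) = p.1.1 := by
  rw [expandFraction]
  push_cast
  rw [mul_div_mul_right _ _ (by positivity), p.1.num_natAbs_div_den]

theorem expandFraction_injective : Function.Injective expandFraction := by
  rintro p p' h
  have h1 : p.1 = p'.1 := by
    apply Subtype.ext
    rw [← expandFraction_div, h, expandFraction_div]
  refine Prod.ext h1 ?_
  have h2 := congrArg Prod.fst h
  simp only [expandFraction, h1] at h2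
  have := Nat.eq_of_mul_eq_mul_left p'.1.1.den_pos h2
  omega

theorem mem_range_expandFraction {p : ℕ × ℕ} (h0 : 0 < p.2) (h1 : p.2 < p.1) :
    p ∈ Set.range expandFraction := by
  obtain ⟨n, l⟩ := p
  dsimp only at h0 h1
  have hn : (0 : ℚ) < n := by exact_mod_cast h0.trans h1
  have hl : (0 : ℚ) < l := by exact_mod_cast h0
  set r : ℚ := (l : ℚ) / n with hr
  have hr0 : 0 < r := div_pos hl hn
  have hr1 : r < 1 := (div_lt_one hn).2 (by exact_mod_cast h1)
  have hden : (r.den : ℤ) ∣ n := by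
    have := Rat.den_dvd (l : ℤ) (n : ℤ)
    rwa [Rat.divInt_eq_div, Int.cast_natCast, Int.cast_natCast] at this
  obtain ⟨c, hc⟩ := Int.natCast_dvd_natCast.1 hden
  have hc0 : c ≠ 0 := by
    rintro rfl
    omega
  obtain ⟨i, rfl⟩ := Nat.exists_eq_succ_of_ne_zero hc0
  refine ⟨(⟨r, hr0, hr1⟩, i), ?_⟩
  refine Prod.ext hc.symm ?_
  have h2 := expandFraction_div (⟨r, hr0, hr1⟩, i)
  have h3 : (expandFraction (⟨r, hr0, hr1⟩, i)).1 = n := hc.symm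
  rw [h3] at h2
  replace h2 := h2.trans hr
  rw [div_left_inj' hn.ne'] at h2
  exact_mod_cast h2

/-- Summation over all fractions, reduced or not, grouped by their value. -/
theorem hasSum_stairWidth_mul (hk : 2 ≤ k) {g : ℚ → ℝ} {B : ℝ} (hB : ∀ r, |g r| ≤ B) :
    HasSum (fun r : UnitRat => stairWidth k r.1.den * g r.1)
      (((k : ℝ) - 1) ^ 2 * ∑' n, ((k : ℝ)⁻¹) ^ n * fractionSum g n) := by
  have hk' : (2 : ℝ) ≤ k := by exact_mod_cast hk
  -- `G (n, l)` is the contribution of the fraction `l / n`. It vanishes off the range of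
  -- `expandFraction`, so its sum can be computed by rows or by reduced fractions.
  set G : ℕ × ℕ → ℝ := fun p => if 0 < p.2 ∧ p.2 < p.1 then
    ((k : ℝ) - 1) ^ 2 * ((k : ℝ)⁻¹) ^ p.1 * g ((p.2 : ℚ) / p.1) else 0 with hG
  have hfib : ∀ (g : ℚ → ℝ) (n : ℕ), HasSum (fun l => if 0 < l ∧ l < n then
      ((k : ℝ) - 1) ^ 2 * ((k : ℝ)⁻¹) ^ n * g ((l : ℚ) / n) else 0)
      (((k : ℝ) - 1) ^ 2 * (((k : ℝ)⁻¹) ^ n * fractionSum g n)) := by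
    intro g n
    have : ((k : ℝ) - 1) ^ 2 * (((k : ℝ)⁻¹) ^ n * fractionSum g n) =
        ∑ l ∈ Finset.Ioo 0 n, if 0 < l ∧ l < n then
          ((k : ℝ) - 1) ^ 2 * ((k : ℝ)⁻¹) ^ n * g ((l : ℚ) / n) else 0 := by
      rw [fractionSum, ← mul_assoc, Finset.mul_sum]
      refine Finset.sum_congr rfl fun l hl => ?_
      rw [if_pos (Finset.mem_Ioo.1 hl)]
    rw [this]
    exact hasSum_sum_of_ne_finset_zero fun l hl => if_neg fun h => hl (Finset.mem_Ioo.2 h)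
  have hsum : Summable G := by
    have habs : Summable fun p => |G p| := by
      have hG' : (fun p => |G p|) = fun p : ℕ × ℕ => if 0 < p.2 ∧ p.2 < p.1 then
          ((k : ℝ) - 1) ^ 2 * ((k : ℝ)⁻¹) ^ p.1 * |g ((p.2 : ℚ) / p.1)| else 0 := by
        funext p
        rw [hG]
        dsimp only
        split_ifs
        · rw [abs_mul, abs_of_nonneg (by positivity)]
        · exact abs_zero
      rw [hG']
      refine (summable_prod_of_nonneg fun p => ?_).2 ?_
      · dsimp only
        split_ifs
        · positivity
        · exact le_rfl
      refine ⟨fun n => (hfib (fun r => |g r|) n).summable, ?_⟩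
      refine ((summable_geometric_mul_of_linear_bound hk
        (abs_fractionSum_le (g := fun r => |g r|) (B := B) ?_)).mul_left
          (((k : ℝ) - 1) ^ 2)).congr fun n => ((hfib (fun r => |g r|) n).tsum_eq).symm
      simpa using hB
    exact habs.of_abs
  have hval : ∑' p, G p = ((k : ℝ) - 1) ^ 2 * ∑' n, ((k : ℝ)⁻¹) ^ n * fractionSum g n := by
    rw [hsum.tsum_prod' fun n => (hfib g n).summable, ← tsum_mul_left]
    exact tsum_congr fun n => (hfib g n).tsum_eq
  have hGe : HasSum (G ∘ expandFraction)
      (((k : ℝ) - 1) ^ 2 * ∑' n, ((k : ℝ)⁻¹) ^ n * fractionSum g n) := by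
    rw [expandFraction_injective.hasSum_iff, ← hval]
    · exact hsum.hasSum
    · intro p hp
      refine if_neg fun h => hp (mem_range_expandFraction h.1 h.2)
  refine hGe.prod_fiberwise fun r => ?_
  have hr : ∀ i : ℕ, (G ∘ expandFraction) (r, i) =
      ((k : ℝ) - 1) ^ 2 * ((k : ℝ)⁻¹) ^ (r.1.den * (i + 1)) * g r.1 := by
    intro i
    simp only [Function.comp_apply, hG]
    rw [if_pos, expandFraction_div]
    · rfl
    · exact ⟨Nat.mul_pos r.natAbs_num_pos i.succ_pos,
        Nat.mul_lt_mul_of_pos_right r.natAbs_num_lt_den i.succ_pos⟩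
  simp_rw [hr]
  exact (hasSum_stairWidth hk _ r.1.den_pos).mul_right _

/-- Averages with geometric weights of the increments of a sequence of linear growth. -/
theorem tendsto_average_increments (hk : 2 ≤ k) {S : ℕ → ℝ} {B : ℝ} (h0 : S 0 = 0)
    (hS : ∀ n, |S n| ≤ n * B) :
    Tendsto (fun n : ℕ => (∑ h ∈ Finset.range (n + 1), (k : ℝ) ^ (n - h) * (S (h + 1) - S h)) /
      ∑ h ∈ Finset.range (n + 1), (k : ℝ) ^ (n - h)) atTop
      (𝓝 (((k : ℝ) - 1) ^ 2 * ∑' n, ((k : ℝ)⁻¹) ^ (n + 1) * S n)) := by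
  have hk' : (2 : ℝ) ≤ k := by exact_mod_cast hk
  have hk0 : (k : ℝ) ≠ 0 := by linarith
  have hq : (k : ℝ)⁻¹ < 1 := inv_lt_one_of_one_lt₀ (by linarith)
  have hpow : ∀ n h : ℕ, h ∈ Finset.range (n + 1) →
      (k : ℝ) ^ (n - h) = (k : ℝ) ^ n * ((k : ℝ)⁻¹) ^ h := by
    intro n h hh
    rw [inv_pow, pow_sub₀ _ hk0 (Nat.lt_succ_iff.1 (Finset.mem_range.1 hh))]
  have hsum := summable_geometric_mul_of_linear_bound hk hS
  set A := ∑' n, ((k : ℝ)⁻¹) ^ n * S n with hA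
  have hshift : HasSum (fun n => ((k : ℝ)⁻¹) ^ n * S (n + 1)) (k * A) := by
    have h1 : HasSum (fun n => ((k : ℝ)⁻¹) ^ (n + 1) * S (n + 1)) A := by
      rw [hasSum_nat_add_iff (f := fun n => ((k : ℝ)⁻¹) ^ n * S n) 1]
      rw [hA]
      simpa [h0] using hsum.hasSum
    refine HasSum.congr_fun (h1.mul_left (k : ℝ)) fun n => ?_
    rw [pow_succ]
    field_simp
  have hnum : HasSum (fun n => ((k : ℝ)⁻¹) ^ n * (S (n + 1) - S n)) (k * A - A) := by
    simpa only [mul_sub] using hshift.sub hsum.hasSum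
  have hden := hasSum_geometric_of_lt_one (r := (k : ℝ)⁻¹) (by positivity) hq
  have h1 := hnum.tendsto_sum_nat.comp (tendsto_add_atTop_nat 1)
  have h2 := hden.tendsto_sum_nat.comp (tendsto_add_atTop_nat 1)
  have hq0 : 1 - (k : ℝ)⁻¹ ≠ 0 := by linarith
  have h3 := h1.div h2 (inv_ne_zero hq0)
  convert h3 using 1
  · funext n
    rw [Finset.sum_congr rfl fun h hh => by rw [hpow n h hh, mul_assoc],
      Finset.sum_congr rfl fun h hh => hpow n h hh, ← Finset.mul_sum, ← Finset.mul_sum,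
      mul_div_mul_left _ _ (pow_ne_zero _ hk0)]
    rfl
  · congr 1
    have : ∑' n, ((k : ℝ)⁻¹) ^ (n + 1) * S n = (k : ℝ)⁻¹ * A := by
      rw [hA, ← tsum_mul_left]
      exact tsum_congr fun n => by ring
    rw [this, div_inv_eq_mul]
    field_simp

theorem tsum_fractionSum_succ (hk : 2 ≤ k) {g : ℚ → ℝ} {B : ℝ} (hB : ∀ r, |g r| ≤ B) :
    ∑' n, ((k : ℝ)⁻¹) ^ (n + 1) * fractionSum g (n + 1) =
      ∑' n, ((k : ℝ)⁻¹) ^ n * fractionSum g n := by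
  rw [(summable_geometric_mul_of_linear_bound hk (abs_fractionSum_le hB)).tsum_eq_zero_add]
  simp [fractionSum]

theorem hasSum_stairWidth_den (hk : 2 ≤ k) :
    HasSum (fun r : UnitRat => stairWidth k r.1.den) 1 := by
  have hk' : (2 : ℝ) ≤ k := by exact_mod_cast hk
  have h1 := hasSum_stairWidth_mul hk (g := fun _ => 1) (B := 1) (by simp)
  have hval : ∀ n, fractionSum (fun _ => 1) (n + 1) = n := by
    intro n
    simp [fractionSum]
  -- All increments of `S n = n` are 1, so every average is 1; this evaluates the series without
  -- computing it.
  have h2 := tendsto_average_increments hk (S := fun n => n) (B := 1) (by simp) (by simp)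
  rw [← tsum_fractionSum_succ hk (B := 1) (by simp)] at h1
  simp only [hval, mul_one] at h1
  convert h1 using 1
  refine tendsto_nhds_unique (Tendsto.congr (fun n => ?_) tendsto_const_nhds) h2
  symm
  have : ∀ h : ℕ, (k : ℝ) ^ (n - h) * (((h + 1 : ℕ) : ℝ) - h) = (k : ℝ) ^ (n - h) := by
    intro h
    push_cast
    ring
  simp only [this]
  refine div_self (Finset.sum_pos (fun h _ => by positivity) (by simp)).ne'

end RationalAtoms

/-! ### Quantile measure of a densely atomic distribution. -/

/-- The set of values and left limits of the distribution function of `μ` on `[a, b]`. -/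
def cdfRange (μ : Measure ℝ) (a b : ℝ) : Set ℝ :=
  {t | ∃ c ∈ Icc a b, t = μ.real (Iic c) ∨ t = μ.real (Iio c)}

section Quantile

variable {μ : Measure ℝ} {A : Set ℝ} {a b : ℝ}

/-- `μ` is carried by a countable set of atoms that is contained and dense in `(a, b)`. -/
structure IsDenselyAtomic (μ : Measure ℝ) (A : Set ℝ) (a b : ℝ) : Prop where
  lt : a < b
  countable : A.Countable
  subset : A ⊆ Ioo a b
  dense : ∀ x y, a ≤ x → x < y → y ≤ b → ∃ c ∈ A, x < c ∧ c < y
  pos : ∀ c ∈ A, 0 < μ.real {c}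
  compl : μ Aᶜ = 0

theorem Iic_mem_cdfRange {x : ℝ} (hx : x ∈ Icc a b) : μ.real (Iic x) ∈ cdfRange μ a b :=
  ⟨x, hx, Or.inl rfl⟩

theorem Iio_mem_cdfRange {x : ℝ} (hx : x ∈ Icc a b) : μ.real (Iio x) ∈ cdfRange μ a b :=
  ⟨x, hx, Or.inr rfl⟩

namespace IsDenselyAtomic

theorem singleton_eq_zero (h : IsDenselyAtomic μ A a b) {c : ℝ} (hc : c ∉ A) :
    μ.real {c} = 0 := by
  have : μ {c} = 0 := measure_mono_null (by simpa using hc) h.compl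
  simp [measureReal_def, this]

theorem left_notMem (h : IsDenselyAtomic μ A a b) : a ∉ A := fun ha => lt_irrefl _ (h.subset ha).1

theorem right_notMem (h : IsDenselyAtomic μ A a b) : b ∉ A :=
  fun hb => lt_irrefl _ (h.subset hb).2

theorem left_eq_zero (h : IsDenselyAtomic μ A a b) : μ.real (Iic a) = 0 := by
  have : μ (Iic a) = 0 := by
    refine measure_mono_null ?_ h.compl
    intro x hx hxA
    exact absurd (h.subset hxA).1 (not_lt.2 hx)
  simp [measureReal_def, this]

end IsDenselyAtomic

variable [IsProbabilityMeasure μ]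

theorem measureReal_Iic_le_Iio {x y : ℝ} (h : x < y) : μ.real (Iic x) ≤ μ.real (Iio y) :=
  measureReal_mono (Iic_subset_Iio.2 h)

theorem measureReal_Iio_le_Iic (x : ℝ) : μ.real (Iio x) ≤ μ.real (Iic x) :=
  measureReal_mono Iio_subset_Iic_self

theorem measureReal_Iic_mono {x y : ℝ} (h : x ≤ y) : μ.real (Iic x) ≤ μ.real (Iic y) :=
  measureReal_mono (Iic_subset_Iic.2 h)

theorem measureReal_Iic_eq_add (x : ℝ) : μ.real (Iic x) = μ.real (Iio x) + μ.real {x} := by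
  rw [← measureReal_union (by simp) (measurableSet_singleton x), Iio_union_right]

theorem exists_gt_measureReal_Iic_lt {c u : ℝ} (h : μ.real (Iic c) < u) :
    ∃ d > c, ∀ x, x < d → μ.real (Iic x) < u := by
  have hc : ContinuousWithinAt (cdf μ) (Ici c) c := (cdf μ).right_continuous c
  rw [← cdf_eq_real] at h
  have := hc.eventually (gt_mem_nhds h)
  rw [eventually_iff, mem_nhdsGE_iff_exists_Ico_subset] at this
  obtain ⟨d, hd, hs⟩ := this
  refine ⟨d, hd, fun x hx => ?_⟩
  rcases le_total c x with hcx | hcx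
  · simpa [cdf_eq_real] using hs ⟨hcx, hx⟩
  · rw [← cdf_eq_real]
    exact ((monotone_cdf μ) hcx).trans_lt h

theorem exists_lt_lt_measureReal_Iic {c u : ℝ} (h : u < μ.real (Iio c)) :
    ∃ d < c, ∀ x, d < x → u < μ.real (Iic x) := by
  by_contra! hcon
  have hU : Iio c = ⋃ n : ℕ, Iic (c - 1 / ((n : ℝ) + 1)) := by
    ext x
    simp only [mem_Iio, mem_iUnion, mem_Iic]
    constructor
    · intro hx
      obtain ⟨n, hn⟩ := exists_nat_one_div_lt (sub_pos.2 hx)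
      exact ⟨n, by linarith⟩
    · rintro ⟨n, hn⟩
      have : (0 : ℝ) < 1 / ((n : ℝ) + 1) := by positivity
      linarith
  have hm : Monotone fun n : ℕ => Iic (c - 1 / ((n : ℝ) + 1)) := by
    intro i j hij
    have := Nat.one_div_le_one_div (α := ℝ) hij
    exact Iic_subset_Iic.2 (by linarith)
  have ht := tendsto_measure_iUnion_atTop (μ := μ) hm
  rw [← hU] at ht
  have ht' := (ENNReal.tendsto_toReal (measure_ne_top μ (Iio c))).comp ht
  refine absurd (le_of_tendsto' ht' (b := u) fun n => ?_) (not_le.2 h)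
  have hp : (0 : ℝ) < 1 / ((n : ℝ) + 1) := by positivity
  obtain ⟨x, hx, hxu⟩ := hcon (c - 1 / ((n : ℝ) + 1)) (by linarith)
  exact (measureReal_Iic_mono hx.le).trans hxu

/-- The quantile function is the lower adjoint of the distribution function. -/
theorem le_measureReal_Iic_iff_quantile_le {t : ℝ} (h0 : 0 < t) (h1 : t < 1) (x : ℝ) :
    t ≤ μ.real (Iic x) ↔ quantile μ t ≤ x := by
  have hne : {x : ℝ | t ≤ cdf μ x}.Nonempty := by
    obtain ⟨x, hx⟩ := ((tendsto_cdf_atTop μ).eventually (lt_mem_nhds h1)).exists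
    exact ⟨x, hx.le⟩
  have hbdd : BddBelow {x : ℝ | t ≤ cdf μ x} := by
    obtain ⟨y, hy⟩ := ((tendsto_cdf_atBot μ).eventually (gt_mem_nhds h0)).exists
    refine ⟨y, fun x hx => ?_⟩
    by_contra! hlt
    exact absurd ((monotone_cdf μ) hlt.le) (not_le.2 (hy.trans_le hx))
  rw [← cdf_eq_real]
  constructor
  · exact fun h => csInf_le hbdd h
  · intro h
    by_contra! hlt
    rw [cdf_eq_real] at hlt
    obtain ⟨d, hd, hd'⟩ := exists_gt_measureReal_Iic_lt hlt
    obtain ⟨z, hz, hzd⟩ := (csInf_lt_iff hbdd hne).1 (h.trans_lt hd)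
    have hz' : t ≤ cdf μ z := hz
    rw [cdf_eq_real] at hz'
    exact absurd (hd' z hzd) (not_lt.2 hz')

theorem measurable_measureReal_Iic : Measurable fun x => μ.real (Iic x) :=
  Monotone.measurable fun _ _ h => measureReal_Iic_mono h

variable (μ) in
/-- The image under the distribution function of Lebesgue measure on `(a, b)`. -/
noncomputable def cdfImage (a b : ℝ) : Measure ℝ :=
  (volume.restrict (Ioo a b)).map fun x => μ.real (Iic x)

theorem cdfImage_apply {s : Set ℝ} (hs : MeasurableSet s) :
    cdfImage μ a b s = volume ((fun x => μ.real (Iic x)) ⁻¹' s ∩ Ioo a b) := by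
  rw [cdfImage, Measure.map_apply measurable_measureReal_Iic hs,
    Measure.restrict_apply (measurable_measureReal_Iic hs)]

namespace IsDenselyAtomic

theorem Iio_eq_Iic (h : IsDenselyAtomic μ A a b) {c : ℝ} (hc : c ∉ A) :
    μ.real (Iio c) = μ.real (Iic c) := by
  rw [measureReal_Iic_eq_add, h.singleton_eq_zero hc, add_zero]

theorem Iio_lt_Iic (h : IsDenselyAtomic μ A a b) {c : ℝ} (hc : c ∈ A) :
    μ.real (Iio c) < μ.real (Iic c) := by
  rw [measureReal_Iic_eq_add]
  linarith [h.pos c hc]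

theorem right_eq_one (h : IsDenselyAtomic μ A a b) : μ.real (Iio b) = 1 := by
  have : μ (Iio b)ᶜ = 0 := by
    refine measure_mono_null ?_ h.compl
    intro x hx hxA
    exact hx (h.subset hxA).2
  rw [measureReal_def, (prob_compl_eq_zero_iff measurableSet_Iio).1 this, ENNReal.toReal_one]

theorem Iic_lt_Iio (h : IsDenselyAtomic μ A a b) {x y : ℝ} (hx : a ≤ x) (hxy : x < y)
    (hy : y ≤ b) : μ.real (Iic x) < μ.real (Iio y) := by
  obtain ⟨c, hc, hxc, hcy⟩ := h.dense x y hx hxy hy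
  calc μ.real (Iic x) ≤ μ.real (Iio c) := measureReal_Iic_le_Iio hxc
    _ < μ.real (Iic c) := h.Iio_lt_Iic hc
    _ ≤ μ.real (Iio y) := measureReal_Iic_le_Iio hcy

theorem Iic_mem_Ioo (h : IsDenselyAtomic μ A a b) {x : ℝ} (hx : x ∈ Ioo a b) :
    μ.real (Iic x) ∈ Ioo (0 : ℝ) 1 := by
  constructor
  · rw [← h.left_eq_zero]
    exact (h.Iic_lt_Iio le_rfl hx.1 hx.2.le).trans_le (measureReal_Iio_le_Iic x)
  · rw [← h.right_eq_one]
    exact h.Iic_lt_Iio hx.1.le hx.2 le_rfl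

/-- By the adjunction, `F` pulls `[s, t)` back to the interval from `Q(s)` to `Q(t)`, which lies in
`[a, b)` and whose length is the required mass. -/
theorem isQuantileMeasure_cdfImage (h : IsDenselyAtomic μ A a b) :
    IsQuantileMeasure μ (cdfImage μ a b) := by
  constructor
  · rw [cdfImage_apply measurableSet_Ioo.compl]
    convert measure_empty (μ := (volume : Measure ℝ))
    ext x
    simp only [mem_inter_iff, mem_preimage, mem_compl_iff, mem_empty_iff_false, iff_false, not_and]
    exact fun hx hx' => hx (h.Iic_mem_Ioo hx')
  · intro s t hs hst ht
    have key : (fun x => μ.real (Iic x)) ⁻¹' Ico s t = Ico (quantile μ s) (quantile μ t) := by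
      ext x
      rw [mem_preimage, mem_Ico, mem_Ico, ← not_le,
        le_measureReal_Iic_iff_quantile_le hs (hst.trans_lt ht),
        le_measureReal_Iic_iff_quantile_le (hs.trans_le hst) ht, not_le]
    have hsub : Ico (quantile μ s) (quantile μ t) ⊆ Ico a b := by
      have hlow : a ≤ quantile μ s := by
        by_contra! hlt
        have := (le_measureReal_Iic_iff_quantile_le hs (hst.trans_lt ht) a).2 hlt.le
        rw [h.left_eq_zero] at this
        linarith
      have hupp : quantile μ t ≤ b := by
        rw [← le_measureReal_Iic_iff_quantile_le (hs.trans_le hst) ht, ← h.Iio_eq_Iic h.right_notMem,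
          h.right_eq_one]
        exact ht.le
      exact Ico_subset_Ico hlow hupp
    have hae : volume (Ico (quantile μ s) (quantile μ t) ∩ Ioo a b) =
        volume (Ico (quantile μ s) (quantile μ t) ∩ Ico a b) :=
      measure_congr (ae_eq_set_inter Filter.EventuallyEq.rfl Ioo_ae_eq_Ico)
    rw [cdfImage_apply measurableSet_Ico, key,
      hae, inter_eq_left.2 hsub, Real.volume_Ico]

theorem cdfImage_singleton (h : IsDenselyAtomic μ A a b) (t : ℝ) : cdfImage μ a b {t} = 0 := by
  rw [cdfImage_apply (measurableSet_singleton t)]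
  refine Set.Subsingleton.measure_zero (fun x hx y hy => ?_) _
  have key : ∀ x y, a < x → y < b → x < y → μ.real (Iic x) < μ.real (Iic y) := fun x y hx hy hxy =>
    (h.Iic_lt_Iio hx.le hxy hy.le).trans_le (measureReal_Iio_le_Iic y)
  have hx1 : μ.real (Iic x) = t := hx.1
  have hy1 : μ.real (Iic y) = t := hy.1
  rcases lt_trichotomy x y with hxy | hxy | hxy
  · exact absurd (key x y hx.2.1 hy.2.2 hxy) (by simp [hx1, hy1])
  · exact hxy
  · exact absurd (key y x hy.2.1 hx.2.2 hxy) (by simp [hx1, hy1])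

/-- Every level is attained at some point, or jumped over there. -/
theorem exists_Iio_le_le_Iic (h : IsDenselyAtomic μ A a b) {t : ℝ} (ht : t ∈ Icc (0 : ℝ) 1) :
    ∃ c ∈ Icc a b, μ.real (Iio c) ≤ t ∧ t ≤ μ.real (Iic c) := by
  set T : Set ℝ := {x | x ∈ Icc a b ∧ t ≤ μ.real (Iic x)} with hT
  have hb : b ∈ T := ⟨⟨h.lt.le, le_rfl⟩, by
    rw [← h.Iio_eq_Iic h.right_notMem, h.right_eq_one]; exact ht.2⟩
  have hbdd : BddBelow T := ⟨a, fun x hx => hx.1.1⟩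
  have hac : a ≤ sInf T := le_csInf ⟨b, hb⟩ fun x hx => hx.1.1
  have hcb : sInf T ≤ b := csInf_le hbdd hb
  -- Left limits of `F` at the infimum cannot exceed `t` by minimality, and right continuity makes
  -- `F` reach `t` there.
  refine ⟨sInf T, ⟨hac, hcb⟩, ?_, ?_⟩
  · by_contra! hlt
    obtain ⟨d, hd, hd'⟩ := exists_lt_lt_measureReal_Iic hlt
    rcases hac.eq_or_lt with heq | hlt'
    · rw [← heq, h.Iio_eq_Iic h.left_notMem, h.left_eq_zero] at hlt
      linarith [ht.1]
    · obtain ⟨x, hx1, hx2⟩ := exists_between (max_lt hd hlt')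
      have : x ∈ T := ⟨⟨(le_max_right _ _).trans hx1.le, hx2.le.trans hcb⟩,
        (hd' x ((le_max_left _ _).trans_lt hx1)).le⟩
      exact absurd (csInf_le hbdd this) (not_le.2 hx2)
  · by_contra! hlt
    obtain ⟨d, hd, hd'⟩ := exists_gt_measureReal_Iic_lt hlt
    obtain ⟨z, hz, hzd⟩ := (csInf_lt_iff hbdd ⟨b, hb⟩).1 hd
    exact absurd (hd' z hzd) (not_lt.2 hz.2)

theorem disjoint_gap_cdfRange (c : ℝ) :
    Disjoint (Ioo (μ.real (Iio c)) (μ.real (Iic c))) (cdfRange μ a b) := by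
  rw [Set.disjoint_left]
  rintro t ⟨h1, h2⟩ ⟨x, -, rfl | rfl⟩
  · rcases lt_or_ge x c with hx | hx
    · exact absurd (measureReal_Iic_le_Iio (μ := μ) hx) (not_le.2 h1)
    · exact absurd (measureReal_Iic_mono (μ := μ) hx) (not_le.2 h2)
  · rcases le_or_gt x c with hx | hx
    · exact absurd (measureReal_mono (μ := μ) (Iio_subset_Iio hx)) (not_le.2 h1)
    · exact absurd (measureReal_Iic_le_Iio (μ := μ) hx) (not_le.2 h2)

theorem cdfRange_subset_Icc : cdfRange μ a b ⊆ Icc 0 1 := by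
  rintro t ⟨x, -, rfl | rfl⟩ <;> exact ⟨measureReal_nonneg, measureReal_le_one⟩

theorem cdfRange_eq (h : IsDenselyAtomic μ A a b) :
    cdfRange μ a b = Icc 0 1 \ ⋃ c ∈ A, Ioo (μ.real (Iio c)) (μ.real (Iic c)) := by
  apply Subset.antisymm
  · refine fun t ht => ⟨cdfRange_subset_Icc ht, ?_⟩
    simp only [mem_iUnion, not_exists]
    exact fun c _ hc => (Set.disjoint_left.1 (disjoint_gap_cdfRange c) hc) ht
  · rintro t ⟨ht, hgap⟩
    obtain ⟨c, hc, h1, h2⟩ := h.exists_Iio_le_le_Iic ht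
    refine ⟨c, hc, ?_⟩
    rcases h1.eq_or_lt with h1 | h1
    · exact Or.inr h1.symm
    rcases h2.eq_or_lt with h2 | h2
    · exact Or.inl h2
    refine absurd ?_ hgap
    have hcA : c ∈ A := by
      by_contra hcA
      have := h.Iio_eq_Iic hcA
      linarith
    exact mem_biUnion hcA ⟨h1, h2⟩

theorem isClosed_cdfRange (h : IsDenselyAtomic μ A a b) : IsClosed (cdfRange μ a b) := by
  rw [h.cdfRange_eq, sdiff_eq]
  exact isClosed_Icc.inter (isOpen_biUnion fun _ _ => isOpen_Ioo).isClosed_compl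

/-- The removed gaps are disjoint and as long as the masses of the atoms, so their total length is
1. -/
theorem volume_cdfRange (h : IsDenselyAtomic μ A a b) : volume (cdfRange μ a b) = 0 := by
  have hgap : volume (⋃ c ∈ A, Ioo (μ.real (Iio c)) (μ.real (Iic c))) = 1 := by
    rw [measure_biUnion h.countable _ fun _ _ => measurableSet_Ioo]
    · have : ∀ c : A, volume (Ioo (μ.real (Iio (c : ℝ))) (μ.real (Iic (c : ℝ)))) = μ {(c : ℝ)} := by
        intro c
        rw [Real.volume_Ioo, measureReal_Iic_eq_add, add_sub_cancel_left, ofReal_measureReal]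
      have hd : A.PairwiseDisjoint fun c : ℝ => ({c} : Set ℝ) := fun x _ y _ hxy => by
        simpa [Function.onFun] using hxy
      have hA := measure_biUnion (μ := μ) h.countable hd fun c _ => measurableSet_singleton c
      rw [tsum_congr this, ← hA, biUnion_of_singleton,
        ← prob_compl_eq_zero_iff h.countable.measurableSet]
      exact h.compl
    · have key : ∀ x y : ℝ, x < y → Disjoint (Ioo (μ.real (Iio x)) (μ.real (Iic x)))
          (Ioo (μ.real (Iio y)) (μ.real (Iic y))) := fun x y hxy =>
        Set.disjoint_left.2 fun t ht ht' =>
          lt_irrefl t (ht.2.trans_le ((measureReal_Iic_le_Iio hxy).trans ht'.1.le))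
      intro x _ y _ hxy
      rcases lt_or_gt_of_ne hxy with hlt | hlt
      · exact key x y hlt
      · exact (key y x hlt).symm
  rw [h.cdfRange_eq, measure_sdiff _ _ (by simp [hgap]), hgap, Real.volume_Icc]
  · simp
  · simp only [iUnion_subset_iff]
    exact fun c _ => Ioo_subset_Icc_self.trans
      (Icc_subset_Icc measureReal_nonneg measureReal_le_one)
  · exact (isOpen_biUnion fun _ _ => isOpen_Ioo).measurableSet.nullMeasurableSet

theorem cdfImage_compl_cdfRange (h : IsDenselyAtomic μ A a b) :
    cdfImage μ a b (cdfRange μ a b)ᶜ = 0 := by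
  rw [cdfImage_apply h.isClosed_cdfRange.measurableSet.compl]
  convert measure_empty (μ := (volume : Measure ℝ))
  ext x
  simp only [mem_inter_iff, mem_preimage, mem_compl_iff, mem_empty_iff_false, iff_false, not_and]
  exact fun hx hx' => hx (Iic_mem_cdfRange ⟨hx'.1.le, hx'.2.le⟩)

theorem mutuallySingular_cdfImage (h : IsDenselyAtomic μ A a b) :
    cdfImage μ a b ⟂ₘ (volume : Measure ℝ) := by
  refine ⟨(cdfRange μ a b)ᶜ, h.isClosed_cdfRange.measurableSet.compl, h.cdfImage_compl_cdfRange, ?_⟩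
  rw [compl_compl, h.volume_cdfRange]

/-- Points of the range are values approached from the right or left limits approached from
the left. -/
theorem exists_of_mem_cdfRange (h : IsDenselyAtomic μ A a b) {t : ℝ} (ht : t ∈ cdfRange μ a b) :
    (∃ c, a ≤ c ∧ c < b ∧ t = μ.real (Iic c)) ∨ (∃ c, a < c ∧ c ≤ b ∧ t = μ.real (Iio c)) := by
  obtain ⟨c, hc, rfl | rfl⟩ := ht
  · rcases hc.2.eq_or_lt with rfl | hlt
    · exact Or.inr ⟨c, h.lt, le_rfl, (h.Iio_eq_Iic h.right_notMem).symm⟩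
    · exact Or.inl ⟨c, hc.1, hlt, rfl⟩
  · rcases hc.1.eq_or_lt with rfl | hlt
    · exact Or.inl ⟨a, le_rfl, h.lt, h.Iio_eq_Iic h.left_notMem⟩
    · exact Or.inr ⟨c, hlt, hc.2, rfl⟩

/-- Values of the distribution function are limits from the right of other values. -/
theorem exists_right (h : IsDenselyAtomic μ A a b) {c u : ℝ} (hac : a ≤ c) (hcb : c < b)
    (hu : μ.real (Iic c) < u) :
    ∃ d, c < d ∧ d ≤ b ∧ ∀ x ∈ Ioo c d, μ.real (Iic x) ∈ Ioo (μ.real (Iic c)) u := by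
  obtain ⟨d, hd, hd'⟩ := exists_gt_measureReal_Iic_lt hu
  refine ⟨min d b, lt_min hd hcb, min_le_right _ _, fun x hx => ⟨?_, ?_⟩⟩
  · exact (h.Iic_lt_Iio hac hx.1 (hx.2.le.trans (min_le_right _ _))).trans_le
      (measureReal_Iio_le_Iic x)
  · exact hd' x (hx.2.trans_le (min_le_left _ _))

/-- Left limits of the distribution function are limits from the left of values. -/
theorem exists_left (h : IsDenselyAtomic μ A a b) {c u : ℝ} (hac : a < c) (hcb : c ≤ b)
    (hu : u < μ.real (Iio c)) :
    ∃ d, d < c ∧ a ≤ d ∧ ∀ x ∈ Ioo d c, μ.real (Iic x) ∈ Ioo u (μ.real (Iio c)) := by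
  obtain ⟨d, hd, hd'⟩ := exists_lt_lt_measureReal_Iic hu
  refine ⟨max d a, max_lt hd hac, le_max_right _ _, fun x hx => ⟨?_, ?_⟩⟩
  · exact hd' x ((le_max_left _ _).trans_lt hx.1)
  · exact h.Iic_lt_Iio ((le_max_right _ _).trans hx.1.le) hx.2 hcb

/-- The range is closed and carries the measure. Conversely, near each of its points `F` takes
values on a whole interval of arguments, so every neighbourhood has positive mass. -/
theorem support_cdfImage (h : IsDenselyAtomic μ A a b) :
    (cdfImage μ a b).support = cdfRange μ a b := by
  apply Subset.antisymm
  · exact Measure.support_subset_of_isClosed h.isClosed_cdfRange h.cdfImage_compl_cdfRange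
  · intro t ht
    rw [Measure.mem_support_iff_forall]
    intro U hU
    obtain ⟨l, u, htlu, hsub⟩ := mem_nhds_iff_exists_Ioo_subset.1 hU
    refine lt_of_lt_of_le ?_ (measure_mono hsub)
    rw [cdfImage_apply measurableSet_Ioo]
    rcases h.exists_of_mem_cdfRange ht with ⟨c, hac, hcb, rfl⟩ | ⟨c, hac, hcb, rfl⟩
    · obtain ⟨d, hcd, hdb, hd⟩ := h.exists_right hac hcb htlu.2
      refine lt_of_lt_of_le ?_ (measure_mono (s := Ioo c d) fun x hx =>
        ⟨⟨htlu.1.trans (hd x hx).1, (hd x hx).2⟩, hac.trans_lt hx.1, hx.2.trans_le hdb⟩)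
      simpa using hcd
    · obtain ⟨d, hdc, had, hd⟩ := h.exists_left hac hcb htlu.1
      refine lt_of_lt_of_le ?_ (measure_mono (s := Ioo d c) fun x hx =>
        ⟨⟨(hd x hx).1, (hd x hx).2.trans htlu.2⟩, had.trans_lt hx.1, hx.2.trans_le hcb⟩)
      simpa using hdc

/-- For `c < b` the value `F(c)` is approached by the range from the right, and for `a < c` the
limit `F(c-)` from the left. So a point with a gap on its right is 1 or the lower end of a jump, and
symmetrically on the left. -/
theorem endpoints_cdfRange (h : IsDenselyAtomic μ A a b) :
    endpoints (cdfRange μ a b) =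
      {t | t = 0 ∨ t = 1 ∨ ∃ c ∈ A, t = μ.real (Iio c) ∨ t = μ.real (Iic c)} := by
  have hA : ∀ {c}, c ∈ A → c ∈ Icc a b := fun hc => Ioo_subset_Icc_self (h.subset hc)
  ext t
  constructor
  · rintro ⟨ht, ⟨y, hy, hd⟩ | ⟨y, hy, hd⟩⟩
    · have hnot : ∀ c, a ≤ c → c < b → t ≠ μ.real (Iic c) := by
        rintro c hac hcb rfl
        obtain ⟨d, hcd, hdb, hd'⟩ := h.exists_right hac hcb hy
        obtain ⟨x, hx⟩ := exists_between hcd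
        exact Set.disjoint_left.1 hd (hd' x hx)
          (Iic_mem_cdfRange ⟨hac.trans hx.1.le, hx.2.le.trans hdb⟩)
      rcases h.exists_of_mem_cdfRange ht with ⟨c, hac, hcb, hc⟩ | ⟨c, hac, hcb, hc⟩
      · exact absurd hc (hnot c hac hcb)
      · rcases hcb.eq_or_lt with rfl | hcb
        · exact Or.inr (Or.inl (hc.trans h.right_eq_one))
        · refine Or.inr (Or.inr ⟨c, ?_, Or.inl hc⟩)
          by_contra hcA
          exact hnot c hac.le hcb (hc.trans (h.Iio_eq_Iic hcA))
    · have hnot : ∀ c, a < c → c ≤ b → t ≠ μ.real (Iio c) := by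
        rintro c hac hcb rfl
        obtain ⟨d, hcd, hdb, hd'⟩ := h.exists_left hac hcb hy
        obtain ⟨x, hx⟩ := exists_between hcd
        exact Set.disjoint_left.1 hd (hd' x hx)
          (Iic_mem_cdfRange ⟨hdb.trans hx.1.le, hx.2.le.trans hcb⟩)
      rcases h.exists_of_mem_cdfRange ht with ⟨c, hac, hcb, hc⟩ | ⟨c, hac, hcb, hc⟩
      · rcases hac.eq_or_lt with rfl | hac
        · exact Or.inl (hc.trans h.left_eq_zero)
        · refine Or.inr (Or.inr ⟨c, ?_, Or.inr hc⟩)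
          by_contra hcA
          exact hnot c hac hcb.le (hc.trans (h.Iio_eq_Iic hcA).symm)
      · exact absurd hc (hnot c hac hcb)
  · rintro (rfl | rfl | ⟨c, hc, rfl | rfl⟩)
    · refine ⟨h.left_eq_zero ▸ Iic_mem_cdfRange ⟨le_rfl, h.lt.le⟩, Or.inr ⟨-1, by norm_num, ?_⟩⟩
      exact Set.disjoint_left.2 fun x hx hx' => absurd (cdfRange_subset_Icc hx').1 (not_le.2 hx.2)
    · refine ⟨h.right_eq_one ▸ Iio_mem_cdfRange ⟨h.lt.le, le_rfl⟩, Or.inl ⟨2, by norm_num, ?_⟩⟩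
      exact Set.disjoint_left.2 fun x hx hx' => absurd (cdfRange_subset_Icc hx').2 (not_le.2 hx.1)
    · exact ⟨Iio_mem_cdfRange (hA hc), Or.inl ⟨_, h.Iio_lt_Iic hc, disjoint_gap_cdfRange c⟩⟩
    · exact ⟨Iic_mem_cdfRange (hA hc), Or.inr ⟨_, h.Iio_lt_Iic hc, disjoint_gap_cdfRange c⟩⟩

end IsDenselyAtomic

end Quantile

/-! ### The limit measure of the trees and convergence to it. -/

section TreeMeasure

variable {k : ℕ}

/-- The normalized eigenvalue of the trees with angle `π x`, in increasing order. -/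
noncomputable def treePoint (k : ℕ) (x : ℝ) : ℝ := 1 / 2 - Real.cos (Real.pi * x) / √(k : ℝ)

theorem continuous_treePoint (k : ℕ) : Continuous (treePoint k) := by
  unfold treePoint
  fun_prop

theorem strictMonoOn_treePoint (hk : 2 ≤ k) : StrictMonoOn (treePoint k) (Icc 0 1) := by
  intro x hx y hy hxy
  have hs : 0 < √(k : ℝ) := Real.sqrt_pos.2 (by exact_mod_cast (by omega : 0 < k))
  have hpi := Real.pi_pos
  have : Real.cos (Real.pi * y) < Real.cos (Real.pi * x) :=
    Real.strictAntiOn_cos ⟨mul_nonneg hpi.le hx.1, by nlinarith [hx.2]⟩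
      ⟨mul_nonneg hpi.le hy.1, by nlinarith [hy.2]⟩ (by nlinarith)
  unfold treePoint
  have := div_lt_div_of_pos_right this hs
  linarith

theorem UnitRat.mem_Ioo (r : UnitRat) : (r.1 : ℝ) ∈ Ioo (0 : ℝ) 1 :=
  ⟨by exact_mod_cast r.2.1, by exact_mod_cast r.2.2⟩

theorem UnitRat.mem_Icc (r : UnitRat) : (r.1 : ℝ) ∈ Icc (0 : ℝ) 1 := Ioo_subset_Icc_self r.mem_Ioo

theorem stairWidth_pos (hk : 2 ≤ k) {q : ℕ} (hq : 0 < q) : 0 < stairWidth k q := by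
  have hk' : (2 : ℝ) ≤ k := by exact_mod_cast hk
  have h1 : (1 : ℝ) < (k : ℝ) ^ q := one_lt_pow₀ (by linarith) hq.ne'
  unfold stairWidth
  exact div_pos (pow_pos (by linarith) 2) (by linarith)

/-- The limit of the spectral distributions: the normalized eigenvalue at the reduced fraction `r`
has the mass `stairWidth k r.den`. -/
noncomputable def treeMeasure (k : ℕ) : Measure ℝ :=
  Measure.sum fun r : UnitRat =>
    ENNReal.ofReal (stairWidth k r.1.den) • Measure.dirac (treePoint k r.1)

theorem isProbabilityMeasure_treeMeasure (hk : 2 ≤ k) :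
    IsProbabilityMeasure (treeMeasure k) := by
  constructor
  rw [treeMeasure, Measure.sum_apply _ MeasurableSet.univ]
  simp only [Measure.smul_apply, measure_univ, smul_eq_mul, mul_one]
  have h := hasSum_stairWidth_den hk
  rw [← ENNReal.ofReal_tsum_of_nonneg (fun r => (stairWidth_pos hk r.1.den_pos).le) h.summable,
    h.tsum_eq, ENNReal.ofReal_one]

theorem hasSum_integral_treeMeasure (hk : 2 ≤ k) {f : ℝ → ℝ} (hf : Measurable f) {B : ℝ}
    (hB : ∀ x, |f x| ≤ B) :
    HasSum (fun r : UnitRat => stairWidth k r.1.den * f (treePoint k r.1))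
      (∫ x, f x ∂treeMeasure k) := by
  have := isProbabilityMeasure_treeMeasure hk
  have hint : Integrable f (treeMeasure k) :=
    Integrable.of_bound hf.aestronglyMeasurable B (ae_of_all _ hB)
  refine (hasSum_integral_measure hint).congr_fun fun r => ?_
  rw [integral_smul_measure, integral_dirac,
    ENNReal.toReal_ofReal (stairWidth_pos hk r.1.den_pos).le, smul_eq_mul]

open Classical in
theorem hasSum_treeMeasure_real (hk : 2 ≤ k) {s : Set ℝ} (hs : MeasurableSet s) :
    HasSum (fun r : UnitRat => if treePoint k r.1 ∈ s then stairWidth k r.1.den else 0)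
      ((treeMeasure k).real s) := by
  have h := hasSum_integral_treeMeasure hk (f := s.indicator 1) (B := 1)
    (measurable_one.indicator hs) (fun x => by by_cases hx : x ∈ s <;> simp [hx])
  rw [integral_indicator_one hs] at h
  refine h.congr_fun fun r => ?_
  by_cases hx : treePoint k r.1 ∈ s <;> simp [hx]

theorem treePoint_inj (hk : 2 ≤ k) {r r' : UnitRat} :
    treePoint k r.1 = treePoint k r'.1 ↔ r = r' := by
  rw [(strictMonoOn_treePoint hk).injOn.eq_iff r.mem_Icc r'.mem_Icc, Rat.cast_inj, Subtype.ext_iff]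

theorem treeMeasure_real_singleton (hk : 2 ≤ k) (r : UnitRat) :
    (treeMeasure k).real {treePoint k r.1} = stairWidth k r.1.den := by
  classical
  have h := hasSum_treeMeasure_real hk (measurableSet_singleton (treePoint k r.1))
  refine h.unique ((hasSum_ite_eq r (stairWidth k r.1.den)).congr_fun fun r' => ?_)
  simp only [mem_singleton_iff, treePoint_inj hk]
  split_ifs with h
  · rw [h]
  · rfl

/-- The atoms of the limit measure. -/
def treeAtoms (k : ℕ) : Set ℝ := range fun r : UnitRat => treePoint k r.1

theorem isDenselyAtomic_treeMeasure (hk : 2 ≤ k) :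
    IsDenselyAtomic (treeMeasure k) (treeAtoms k) (treePoint k 0) (treePoint k 1) where
  lt := strictMonoOn_treePoint hk (by simp) (by simp) one_pos
  countable := countable_range _
  subset := by
    rintro _ ⟨r, rfl⟩
    exact ⟨strictMonoOn_treePoint hk (by simp) r.mem_Icc r.mem_Ioo.1,
      strictMonoOn_treePoint hk r.mem_Icc (by simp) r.mem_Ioo.2⟩
  dense := by
    intro x y hx hxy hy
    have hmem : ∀ z, treePoint k 0 ≤ z → z ≤ treePoint k 1 → ∃ u ∈ Icc (0 : ℝ) 1,
        treePoint k u = z := fun z h0 h1 =>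
      intermediate_value_Icc zero_le_one (continuous_treePoint k).continuousOn ⟨h0, h1⟩
    obtain ⟨u, hu, rfl⟩ := hmem x hx (hxy.le.trans hy)
    obtain ⟨v, hv, rfl⟩ := hmem y (hx.trans hxy.le) hy
    obtain ⟨r, hur, hrv⟩ := exists_rat_btwn (((strictMonoOn_treePoint hk).lt_iff_lt hu hv).1 hxy)
    have hr0 : (0 : ℝ) < r := hu.1.trans_lt hur
    have hr1 : (r : ℝ) < 1 := hrv.trans_le hv.2
    let r' : UnitRat := ⟨r, by exact_mod_cast hr0, by exact_mod_cast hr1⟩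
    exact ⟨_, ⟨r', rfl⟩, strictMonoOn_treePoint hk hu r'.mem_Icc hur,
      strictMonoOn_treePoint hk r'.mem_Icc hv hrv⟩
  pos := by
    rintro _ ⟨r, rfl⟩
    dsimp only
    rw [treeMeasure_real_singleton hk]
    exact stairWidth_pos hk r.1.den_pos
  compl := by
    have hA : MeasurableSet (treeAtoms k) := (countable_range _).measurableSet
    rw [treeMeasure, Measure.sum_apply _ hA.compl]
    refine ENNReal.tsum_eq_zero.2 fun r => ?_
    rw [Measure.smul_apply, Measure.dirac_apply' _ hA.compl]
    simp [treeAtoms]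

/-- The denominator and the numerator of a reduced fraction. -/
def denNum (r : UnitRat) : ℕ+ × ℕ := (⟨r.1.den, r.1.den_pos⟩, r.1.num.natAbs)

theorem denNum_injective : Function.Injective denNum := by
  intro r r' h
  have h1 : r.1.den = r'.1.den := congrArg (fun p => (p.1 : ℕ)) h
  have h2 : r.1.num.natAbs = r'.1.num.natAbs := congrArg Prod.snd h
  apply Subtype.ext
  rw [← r.num_natAbs_div_den, ← r'.num_natAbs_div_den, h1, h2]

theorem exists_unitRat {l n : ℕ} (hl : 0 < l) (hln : l < n) (hc : Nat.gcd l n = 1) :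
    ∃ r : UnitRat, r.1.den = n ∧ r.1.num.natAbs = l ∧ (r.1 : ℝ) = (l : ℝ) / n := by
  have hn : (0 : ℚ) < n := by exact_mod_cast hl.trans hln
  have hl' : (0 : ℚ) < l := by exact_mod_cast hl
  have hn' : (0 : ℤ) < n := by exact_mod_cast hl.trans hln
  refine ⟨⟨(l : ℚ) / n, div_pos hl' hn, (div_lt_one hn).2 (by exact_mod_cast hln)⟩, ?_, ?_, ?_⟩
  · have := Rat.den_div_eq_of_coprime (a := l) (b := n) hn' (by simpa using hc)
    simp only [Int.cast_natCast] at this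
    dsimp only
    exact_mod_cast this
  · have := Rat.num_div_eq_of_coprime (a := l) (b := n) hn' (by simpa using hc)
    simp only [Int.cast_natCast] at this
    dsimp only
    rw [this, Int.natAbs_natCast]
  · push_cast
    rfl

/-- The mass to the left of the point at `a / m` is the sum over reduced fractions below `a / m`,
grouped by denominator. Since `a ≤ m`, the bound on the numerator already puts the fraction below 1.
-/
theorem hasSum_stairWidth_mul_coprimeCount (hk : 2 ≤ k) {a m : ℕ} (hm : 1 ≤ m) (ham : a ≤ m) :
    HasSum (fun n : ℕ+ => stairWidth k n * (coprimeCount a m n : ℝ))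
      ((treeMeasure k).real (Iio (treePoint k ((a : ℝ) / m)))) := by
  classical
  have hm' : (0 : ℝ) < m := by exact_mod_cast hm
  have ham' : (a : ℝ) ≤ m := by exact_mod_cast ham
  have hx : (a : ℝ) / m ∈ Icc (0 : ℝ) 1 := ⟨by positivity, (div_le_one hm').2 ham'⟩
  have hlt : ∀ {l : ℕ} {n : ℕ+}, (l : ℝ) < (a : ℝ) * n / m → l < n := by
    intro l n h
    have hn : (0 : ℝ) < n := by exact_mod_cast n.pos
    have : (a : ℝ) * n / m ≤ n := by
      rw [div_le_iff₀ hm', mul_comm]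
      gcongr
    exact_mod_cast h.trans_le this
  set H : ℕ+ × ℕ → ℝ := fun p =>
    if 0 < p.2 ∧ Nat.gcd p.2 p.1 = 1 ∧ (p.2 : ℝ) < (a : ℝ) * p.1 / m then stairWidth k p.1 else 0
    with hH
  have hcomp : HasSum (H ∘ denNum) ((treeMeasure k).real (Iio (treePoint k ((a : ℝ) / m)))) := by
    refine (hasSum_treeMeasure_real hk measurableSet_Iio).congr_fun fun r => ?_
    have hden : (0 : ℝ) < r.1.den := by exact_mod_cast r.1.den_pos
    have hiff : (0 < r.1.num.natAbs ∧ Nat.gcd r.1.num.natAbs r.1.den = 1 ∧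
        (r.1.num.natAbs : ℝ) < (a : ℝ) * r.1.den / m) ↔
        treePoint k r.1 ∈ Iio (treePoint k ((a : ℝ) / m)) := by
      rw [mem_Iio, (strictMonoOn_treePoint hk).lt_iff_lt r.mem_Icc hx, r.cast_eq_div, div_lt_iff₀ hden,
        div_mul_eq_mul_div]
      exact ⟨fun h => h.2.2, fun h => ⟨r.natAbs_num_pos, r.1.reduced, h⟩⟩
    exact if_congr hiff rfl rfl
  have hHsum : HasSum H ((treeMeasure k).real (Iio (treePoint k ((a : ℝ) / m)))) := by
    rwa [denNum_injective.hasSum_iff] at hcomp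
    rintro ⟨n, l⟩ hp
    refine if_neg fun h => hp ?_
    obtain ⟨r, h1, h2, -⟩ := exists_unitRat h.1 (hlt h.2.2) h.2.1
    exact ⟨r, Prod.ext (Subtype.ext h1) h2⟩
  refine hHsum.prod_fiberwise fun n => ?_
  set s : Finset ℕ := (Finset.range n).filter fun l =>
    0 < l ∧ Nat.gcd l n = 1 ∧ (l : ℝ) < (a : ℝ) * n / m with hs
  have hcount : coprimeCount a m n = s.card := by
    rw [coprimeCount, ← Set.ncard_coe_finset]
    congr 1
    ext l
    simp only [hs, mem_ofPred_eq, Finset.coe_filter, Finset.mem_range]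
    exact ⟨fun h => ⟨hlt h.2.2, h⟩, fun h => h.2⟩
  have hsum : stairWidth k n * (coprimeCount a m n : ℝ) = ∑ l ∈ s, H (n, l) := by
    have hval : ∀ l ∈ s, H (n, l) = stairWidth k n := fun l hl =>
      if_pos (Finset.mem_filter.1 hl).2
    rw [Finset.sum_congr rfl hval, Finset.sum_const, nsmul_eq_mul, hcount, mul_comm]
  rw [hsum]
  refine hasSum_sum_of_ne_finset_zero fun l hl => if_neg fun h => hl ?_
  exact Finset.mem_filter.2 ⟨Finset.mem_range.2 (hlt h.2.2), h⟩

/-- The jump at a reduced fraction `a / m` has height `stairWidth k m`, so `ε` selects its lower or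
upper end. For `m = 1` there is no jump, and `a = 0, 1` give the extreme points. -/
theorem endpoints_treeMeasure (hk : 2 ≤ k) :
    {t | t = 0 ∨ t = 1 ∨ ∃ c ∈ treeAtoms k,
      t = (treeMeasure k).real (Iio c) ∨ t = (treeMeasure k).real (Iic c)} =
    {x : ℝ | ∃ m a ε : ℕ, 1 ≤ m ∧ a ≤ m ∧ Nat.gcd a m = 1 ∧ (ε = 0 ∨ (ε = 1 ∧ 2 ≤ m)) ∧
      ∃ S : ℝ, HasSum (fun n : ℕ+ => stairWidth k n * (coprimeCount a m n : ℝ)) S ∧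
        x = ε * stairWidth k m + S} := by
  have := isProbabilityMeasure_treeMeasure hk
  have hd := isDenselyAtomic_treeMeasure hk
  have h0 : (treeMeasure k).real (Iio (treePoint k 0)) = 0 := by
    rw [hd.Iio_eq_Iic hd.left_notMem, hd.left_eq_zero]
  have h1 : (treeMeasure k).real (Iio (treePoint k 1)) = 1 := hd.right_eq_one
  ext t
  constructor
  · rintro (rfl | rfl | ⟨_, ⟨r, rfl⟩, ht⟩)
    · have := hasSum_stairWidth_mul_coprimeCount hk (a := 0) (m := 1) le_rfl zero_le_one
      simp only [Nat.cast_zero, zero_div, h0] at this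
      exact ⟨1, 0, 0, le_rfl, zero_le_one, by simp, Or.inl rfl, 0, by simpa using this, by simp⟩
    · have := hasSum_stairWidth_mul_coprimeCount hk (a := 1) (m := 1) le_rfl le_rfl
      simp only [Nat.cast_one, div_one, h1] at this
      exact ⟨1, 1, 0, le_rfl, le_rfl, by simp, Or.inl rfl, 1, by simpa using this, by simp⟩
    · have hlt := r.natAbs_num_lt_den
      have hpos := r.natAbs_num_pos
      have hsum := hasSum_stairWidth_mul_coprimeCount hk r.1.den_pos hlt.le
      rw [← r.cast_eq_div] at hsum
      rcases ht with rfl | rfl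
      · exact ⟨_, _, 0, r.1.den_pos, hlt.le, r.1.reduced, Or.inl rfl, _, hsum, by simp⟩
      · refine ⟨_, _, 1, r.1.den_pos, hlt.le, r.1.reduced, Or.inr ⟨rfl, by omega⟩, _, hsum, ?_⟩
        rw [measureReal_Iic_eq_add, treeMeasure_real_singleton hk]
        push_cast
        ring
  · rintro ⟨m, a, ε, hm, ham, hgcd, hε, S, hS, rfl⟩
    obtain rfl := hS.unique (hasSum_stairWidth_mul_coprimeCount hk hm ham)
    rcases hm.eq_or_lt with rfl | hm2
    · obtain rfl : ε = 0 := by omega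
      rcases Nat.le_one_iff_eq_zero_or_eq_one.1 ham with rfl | rfl
      · left
        simp [h0]
      · right
        left
        simp [h1]
    · right
      right
      have ha0 : 0 < a := by
        rcases Nat.eq_zero_or_pos a with rfl | h
        · rw [Nat.gcd_zero_left] at hgcd
          omega
        · exact h
      have ham' : a < m := by
        rcases ham.eq_or_lt with rfl | h
        · rw [Nat.gcd_self] at hgcd
          omega
        · exact h
      obtain ⟨r, hden, -, hr⟩ := exists_unitRat ha0 ham' hgcd
      refine ⟨_, ⟨r, rfl⟩, ?_⟩
      dsimp only
      rw [measureReal_Iic_eq_add, treeMeasure_real_singleton hk, hr, hden]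
      rcases hε with rfl | ⟨rfl, -⟩
      · left
        simp
      · right
        push_cast
        ring

theorem integral_normSpecDistribution (k n : ℕ) {f : ℝ → ℝ} (hf : Continuous f) :
    ∫ x, f x ∂(normSpecDistribution k n : Measure ℝ) =
      (∑ v, f (((kTreeAdj_isHermitian k n).eigenvalues v + k) / (2 * k))) /
        Fintype.card (KTreeVertex k n) := by
  -- With the discrete σ-algebra on the nodes the law is a push-forward, and its integral a finite
  -- sum.
  let _ : MeasurableSpace (KTreeVertex k n) := ⊤
  have hm : Measurable fun v : KTreeVertex k n =>
      ((kTreeAdj_isHermitian k n).eigenvalues v + k) / (2 * k) := measurable_from_top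
  show ∫ x, f x ∂(((PMF.uniformOfFintype (KTreeVertex k n)).map
      fun v => ((kTreeAdj_isHermitian k n).eigenvalues v + k) / (2 * k)).toMeasure) = _
  rw [← PMF.toMeasure_map _ _ hm, integral_map hm.aemeasurable hf.aestronglyMeasurable,
    PMF.integral_eq_sum, div_eq_inv_mul, Finset.mul_sum]
  refine Finset.sum_congr rfl fun v _ => ?_
  rw [PMF.uniformOfFintype_apply, ENNReal.toReal_inv, ENNReal.toReal_natCast, smul_eq_mul]

theorem pathSum_eq_fractionSum (hk : 2 ≤ k) (f : ℝ → ℝ) (j : ℕ) :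
    pathSum k (fun x => f ((x + k) / (2 * k))) j =
      fractionSum (fun r => f (treePoint k r)) (j + 1) := by
  have hk0 : (0 : ℝ) < k := by exact_mod_cast (by omega : 0 < k)
  have hs : 0 < √(k : ℝ) := Real.sqrt_pos.2 hk0
  have hs2 : √(k : ℝ) * √(k : ℝ) = k := Real.mul_self_sqrt hk0.le
  have hj : (j : ℝ) + 1 ≠ 0 := by positivity
  have hIoo : Finset.Ioo 0 (j + 1) = (Finset.range j).map (addRightEmbedding 1) := by
    ext l
    simp only [Finset.mem_Ioo, Finset.mem_map, Finset.mem_range, addRightEmbedding_apply]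
    exact ⟨fun h => ⟨l - 1, by omega, by omega⟩, by rintro ⟨i, hi, rfl⟩; omega⟩
  -- The roots are listed with decreasing cosine while `treePoint` increases, hence the reflection
  -- of the index.
  rw [pathSum, fractionSum, hIoo, Finset.sum_map, ← Finset.sum_range_reflect]
  refine Finset.sum_congr rfl fun l hl => ?_
  have hlj : l < j := Finset.mem_range.1 hl
  have hcast : ((j - 1 - l : ℕ) : ℝ) = (j : ℝ) - 1 - l := by
    rw [Nat.sub_sub, Nat.cast_sub (by omega)]
    push_cast
    ring
  have hang : (((j - 1 - l : ℕ) : ℝ) + 1) * Real.pi / (j + 1) =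
      Real.pi - Real.pi * (((l : ℝ) + 1) / (j + 1)) := by
    rw [hcast]
    field_simp
    ring
  rw [hang, Real.cos_pi_sub]
  congr 1
  unfold treePoint
  push_cast [addRightEmbedding_apply]
  field_simp
  linear_combination (-2 * Real.cos (Real.pi * (l + 1) / (j + 1))) * hs2

/-- The limit of the spectral distributions, as a probability measure. -/
noncomputable def treeDistribution (hk : 2 ≤ k) : ProbabilityMeasure ℝ :=
  ⟨treeMeasure k, isProbabilityMeasure_treeMeasure hk⟩

theorem tendsto_normSpecDistribution (hk : 2 ≤ k) :
    Tendsto (fun n => normSpecDistribution k n) atTop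
      (𝓝 (treeDistribution hk)) := by
  have hk0 : 0 < k := by omega
  rw [ProbabilityMeasure.tendsto_iff_forall_integral_tendsto]
  intro f
  have hB : ∀ x, |f x| ≤ ‖f‖ := fun x => f.norm_coe_le_norm x
  set g : ℚ → ℝ := fun r => f (treePoint k r) with hg
  have hgB : ∀ r, |g r| ≤ ‖f‖ := fun r => hB _
  have hlim : ∫ x, f x ∂(treeMeasure k) =
      ((k : ℝ) - 1) ^ 2 * ∑' n, ((k : ℝ)⁻¹) ^ (n + 1) * fractionSum g (n + 1) := by
    rw [tsum_fractionSum_succ hk hgB]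
    exact (hasSum_integral_treeMeasure hk f.continuous.measurable hB).unique
      (hasSum_stairWidth_mul hk hgB)
  have hS : ∀ n, |fractionSum g (n + 1)| ≤ n * ‖f‖ := by
    intro n
    refine (Finset.abs_sum_le_sum_abs _ _).trans ?_
    refine (Finset.sum_le_card_nsmul _ _ ‖f‖ fun l _ => hgB _).trans ?_
    simp
  have h := tendsto_average_increments hk (S := fun n => fractionSum g (n + 1))
    (by simpa using hS 0) hS
  show Tendsto _ _ (𝓝 (∫ x, f x ∂(treeMeasure k)))
  rw [hlim]
  refine h.congr fun n => ?_
  have hcard : (Fintype.card (KTreeVertex k n) : ℝ) =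
      ∑ h ∈ Finset.range (n + 1), (k : ℝ) ^ (n - h) := by
    -- For the constant 1 the spectral sum counts the nodes and each increment of `pathSum` is 1.
    have := sum_eigenvalues_kTreeAdj hk0 n fun _ => 1
    simpa [pathSum] using this
  rw [integral_normSpecDistribution k n f.continuous, hcard,
    sum_eigenvalues_kTreeAdj hk0 n fun x => f ((x + k) / (2 * k))]
  simp only [pathSum_eq_fractionSum hk, hg]

end TreeMeasure

theorem theorem4 (k : ℕ) (hk : 2 ≤ k) :
    ∃ (μ : ProbabilityMeasure ℝ) (ν : Measure ℝ),
      Tendsto (fun n : ℕ => normSpecDistribution k n) atTop (𝓝 μ) ∧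
      IsQuantileMeasure (μ : Measure ℝ) ν ∧
      (∀ t : ℝ, ν {t} = 0) ∧
      ν ⟂ₘ (volume : Measure ℝ) ∧
      volume ν.support = 0 ∧
      endpoints ν.support =
        {x : ℝ | ∃ m a ε : ℕ, 1 ≤ m ∧ a ≤ m ∧ Nat.gcd a m = 1 ∧ (ε = 0 ∨ (ε = 1 ∧ 2 ≤ m)) ∧
          ∃ S : ℝ, HasSum (fun n : ℕ+ => stairWidth k n * (coprimeCount a m n : ℝ)) S ∧
            x = ε * stairWidth k m + S} := by
  have := isProbabilityMeasure_treeMeasure hk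
  have h := isDenselyAtomic_treeMeasure hk
  refine ⟨treeDistribution hk, cdfImage (treeMeasure k) (treePoint k 0) (treePoint k 1),
    tendsto_normSpecDistribution hk, h.isQuantileMeasure_cdfImage, h.cdfImage_singleton,
    h.mutuallySingular_cdfImage, ?_, ?_⟩
  · rw [h.support_cdfImage, h.volume_cdfRange]
  · rw [h.support_cdfImage, h.endpoints_cdfRange, endpoints_treeMeasure hk]
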